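/- **Setting.** Let $T\in\mathbb N$ be a finite horizon, $\gamma\in(0,1]$, $S$ a finite set of states and $A_s$ ($s\in S$) finite nonempty action sets. Every state belongs to exactly one of the stages $1,\dots,T$; $S_t$ denotes the set of states of stage $t$, $S_1=\{s^{ini}\}$, states of $S_t$ ($t<T$) lead to states of $S_{t+1}$ only, and the terminal reward (at stage $T$) is zero. For $s\in S_t$, $t<T$, the parameters are the transition probabilities $\mathbf p_s=(p(s'|s,a))_{a\in A_s,\,s'\in S_{t+1}}$ and the rewards $\mathbf r_s=(r(s,a))_{a\in A_s}$. They are uncertain; with an auxiliary random vector $\tilde{\mathbf u}_s\in\mathbb R^{Q_s}$, the state-wise ambiguity set $\tilde{\mathcal C}_s$ is the set of all distributions $\mu_s$ of $(\mathbf p_s,\mathbf r_s,\tilde{\mathbf u}_s)$ on $\mathbb R^{|A_s||S_{t+1}|}\times\mathbb R^{|A_s|}\times\mathbb R^{Q_s}$ such that $\mathbf p_s$ almost surely consists of transition probabilities, i.e. $p(\cdot|s,a)$ lies in the probability simplex for each $a$, and $$\mathbb E_{\mu_s}[F_s\mathbf p_s+G_s\mathbf r_s+H_s\tilde{\mathbf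 u}_s]=\mathbf c_s,\qquad \mu_s(O_s^i)\in[\underline\alpha_s^i,\overline\alpha_s^i],\quad i=1,\dots,n_s,$$ where $n_s\ge1$, $0\le\underline\alpha_s^i\le\overline\alpha_s^i\le1$, the $F_s,G_s,H_s$ are matrices, $\mathbf c_s$ is a vector, and the $O_s^i$ are sets of parameter vectors. $\mathcal C_s$ is the set of the marginal distributions of $(\mathbf p_s,\mathbf r_s)$ under the elements of $\tilde{\mathcal C}_s$, and $\mathcal C_S$ is the set of the marginal distributions of $(\mathbf p,\mathbf r)=(\mathbf p_s,\mathbf r_s)_s$ under the product distributions $\bigotimes_s\mu_s$, $\mu_s\in\tilde{\mathcal C}_s$. $\Pi^{HR}$ is the set of history-dependent randomized strategies, $u(\pi,\mathbf p,\mathbf r)=\mathbb E_\pi^{(\mathbf p,\mathbf r)}\big[\sum_{i=1}^T\gamma^{i-1}r(s_i,a_i)\big]$ with $s_1=s^{ini}$, and $w(\pi,\mu,s^{ini})=\int u(\pi,\mathbf p,\mathbf r)\,d\mu(\mathbf p,\mathbf r)$. A strategy $\pi^*\in\Pi^{HR}$ is *distributionally robust* with respect to $\mathcal C_S$ if $\inf_{\mu\in\mathcal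 C_S}w(\pi,\mu,s^{ini})\le\inf_{\mu\in\mathcal C_S}w(\pi^*,\mu,s^{ini})$ for all $\pi\in\Pi^{HR}$. The *S-robust values* are defined by $\tilde v_T(s)=0$ for $s\in S_T$ and, for $s\in S_t$ with $t<T$, $$\tilde v_t(s)=\max_{\pi_s\in\Delta(s)}\ \min_{\mu_s\in\mathcal C_s}\ \mathbb E_{(\mathbf p_s,\mathbf r_s)\sim\mu_s}\Big[\sum_{a\in A_s}\pi_s(a)\Big(r(s,a)+\gamma\sum_{s'\in S_{t+1}}p(s'|s,a)\,\tilde v_{t+1}(s')\Big)\Big],$$ where $\Delta(s)$ is the probability simplex on $A_s$ (the maximum and minimum being read as supremum and infimum); a maximizer $\pi_s$ is called an *S-robust action* at $s$. A strategy $\pi^*\in\Pi^{HR}$ is *S-robust* if after every history that ends at a state $s\in S_t$, $t<T$, it prescribes an S-robust action at $s$. **Theorem.** Assume that for every $s\in S_t$ with $t<T$: 1. (nesting) for all $i\ne i'$, either $O_s^i\subseteq\operatorname{int}O_s^{i'}$, or $O_s^{i'}\subseteq\operatorname{int}O_s^i$, or $O_s^i\cap O_s^{i'}=\emptyset$; 2.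 (conic representability) every $O_s^i$ is nonempty, convex, and of the form $\{(\mathbf p_s,\mathbf r_s,\tilde{\mathbf u}_s): B_s^i\mathbf p_s+D_s^i\mathbf r_s+E_s^i\tilde{\mathbf u}_s\preceq_{K_s^i}\mathbf b_s^i\}$ for some matrices, a vector, and a proper cone $K_s^i$ (closed, convex, pointed, with nonempty interior); 3. (bounded support) $O_s^{n_s}$ is bounded and $\underline\alpha_s^{n_s}=\overline\alpha_s^{n_s}=1$; 4. $\tilde{\mathcal C}_s$ is nonempty. Let $\pi^*$ be an S-robust strategy. Then $\pi^*$ is distributionally robust with respect to $\mathcal C_S$. Moreover there is $\mu^*\in\mathcal C_S$ such that $(\pi^*,\mu^*)$ is a saddle point, that is, $$\sup_{\pi\in\Pi^{HR}}w(\pi,\mu^*,s^{ini})=w(\pi^*,\mu^*,s^{ini})=\inf_{\mu\in\mathcal C_S}w(\pi^*,\mu,s^{ini}).$$ -/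

import Mathlib

open MeasureTheory
open scoped Matrix

noncomputable section

/-- The space of parameter vectors `(p, r, ũ)` of one state: `X` indexes the entries of the
transition vector `p`, `Y` the entries of the reward vector `r`, and `ũ` is an auxiliary vector
of length `Q`. -/
abbrev Lifted (X Y : Type*) (Q : ℕ) : Type _ := (X → ℝ) × (Y → ℝ) × (Fin Q → ℝ)

/-- The data of a state-wise ambiguity set in standard form: an affine condition
`E[F p + G r + H ũ] = c` on the mean and finitely many (at least one) confidence sets `O i` with
bounds `lo i ≤ hi i` in `[0, 1]` on their probabilities. The index set `{1, …, n}` is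
`Fin (m + 1)`, and the largest index is `Fin.last m`. -/
structure AmbiguityData (X Y : Type*) where
  k : ℕ
  Q : ℕ
  m : ℕ
  F : Matrix (Fin k) X ℝ
  G : Matrix (Fin k) Y ℝ
  H : Matrix (Fin k) (Fin Q) ℝ
  c : Fin k → ℝ
  O : Fin (m + 1) → Set (Lifted X Y Q)
  lo : Fin (m + 1) → ℝ
  hi : Fin (m + 1) → ℝ
  lo_nonneg : ∀ i, 0 ≤ lo i
  lo_le_hi : ∀ i, lo i ≤ hi i
  hi_le_one : ∀ i, hi i ≤ 1

namespace AmbiguityData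

variable {X Y : Type*}

/-- The nesting condition: of two different confidence sets, one lies in the interior of the
other, or they are disjoint. -/
def Nesting (D : AmbiguityData X Y) : Prop :=
  ∀ i j, i ≠ j →
    D.O i ⊆ interior (D.O j) ∨ D.O j ⊆ interior (D.O i) ∨ Disjoint (D.O i) (D.O j)

/-- The set of all `(p, r, ũ)` with `B p + R r + E ũ ⪯_K b`. -/
def conicSet [Fintype X] [Fintype Y] {Q L : ℕ} (B : Matrix (Fin L) X ℝ) (R : Matrix (Fin L) Y ℝ)
    (E : Matrix (Fin L) (Fin Q) ℝ) (b : Fin L → ℝ) (K : ConvexCone ℝ (Fin L → ℝ)) :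
    Set (Lifted X Y Q) :=
  {x | b - (B *ᵥ x.1 + R *ᵥ x.2.1 + E *ᵥ x.2.2) ∈ K}

/-- A proper cone in the sense of convex optimization: a closed convex cone with nonempty interior
that contains no line. -/
def IsProperCone {L : ℕ} (K : ConvexCone ℝ (Fin L → ℝ)) : Prop :=
  IsClosed (K : Set (Fin L → ℝ)) ∧ K.Salient ∧ (interior (K : Set (Fin L → ℝ))).Nonempty

/-- Conic representability: every confidence set is nonempty, convex, and given by one conic
inequality with respect to a proper cone. -/
def ConicRepresentable [Fintype X] [Fintype Y] (D : AmbiguityData X Y) : Prop :=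
  ∀ i, (D.O i).Nonempty ∧ Convex ℝ (D.O i) ∧
    ∃ (L : ℕ) (B : Matrix (Fin L) X ℝ) (R : Matrix (Fin L) Y ℝ) (E : Matrix (Fin L) (Fin D.Q) ℝ)
      (b : Fin L → ℝ) (K : ConvexCone ℝ (Fin L → ℝ)),
      IsProperCone K ∧ D.O i = conicSet B R E b K

/-- The confidence set with the largest index is bounded and has probability one. -/
def BoundedSupport (D : AmbiguityData X Y) : Prop :=
  Bornology.IsBounded (D.O (Fin.last D.m)) ∧
    D.lo (Fin.last D.m) = 1 ∧ D.hi (Fin.last D.m) = 1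

end AmbiguityData

/-- A distributionally ambiguous Markov decision process with finite horizon `T`, discount factor
`γ`, state set `S`, action sets `A s`, and initial state `sIni`. Every state belongs to exactly one
stage, `stage s`. A state of a stage `t < T` leads to states of stage `t + 1` only; its transition
vector is indexed by the pairs (action, next state), and its parameters are ambiguous. -/
structure DAMDP (S : Type*) (A : S → Type*) where
  T : ℕ
  γ : ℝ
  stage : S → ℕ
  sIni : S
  amb : ∀ s : {s : S // stage s < T},
    AmbiguityData (A s.1 × {s' : S // stage s' = stage s.1 + 1}) (A s.1)

namespace DAMDP

variable {S : Type*} {A : S → Type*}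

/-- The states of the stages before the terminal stage `T`. -/
abbrev Dec (M : DAMDP S A) : Type _ := {s : S // M.stage s < M.T}

/-- The states of the stage that follows the stage of `s`. -/
abbrev Succ (M : DAMDP S A) (s : S) : Type _ := {s' : S // M.stage s' = M.stage s + 1}

/-- The parameters `(p_s, r_s)` of the state `s`. -/
abbrev Param (M : DAMDP S A) (s : S) : Type _ := (A s × M.Succ s → ℝ) × (A s → ℝ)

/-- The parameters `(p_s, r_s, ũ_s)` of the state `s`. -/
abbrev LiftedParam (M : DAMDP S A) (s : M.Dec) : Type _ :=
  Lifted (A s.1 × M.Succ s.1) (A s.1) (M.amb s).Q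

/-- The stages are `1, …, T`, and the first stage consists of the initial state alone. -/
def Staged (M : DAMDP S A) : Prop :=
  (∀ s, 1 ≤ M.stage s ∧ M.stage s ≤ M.T) ∧ ∀ s, M.stage s = 1 ↔ s = M.sIni

/-! ### Strategies and the expected total reward -/

/-- A history is the list of the past pairs (state, action). A (history-dependent randomized)
decision rule assigns weights on `A s` to each history and current state `s`. -/
abbrev Rule (A : S → Type*) : Type _ := List (Σ s, A s) → (s : S) → A s → ℝ

/-- The set of all history-dependent randomized strategies. -/
def strategies (A : S → Type*) [∀ s, Fintype (A s)] : Set (Rule A) :=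
  {π | ∀ h s, π h s ∈ stdSimplex ℝ (A s)}

/-- `h` is a history that ends at the state `s`: the `i`-th state visited belongs to stage `i`. -/
def IsHistory (M : DAMDP S A) (h : List (Σ s, A s)) (s : S) : Prop :=
  (∀ (i : ℕ) (hi : i < h.length), M.stage (h[i]).1 = i + 1) ∧ M.stage s = h.length + 1

/-- The transition probability `p(s' | s, a)`. -/
def trans (M : DAMDP S A) (x : ∀ s : M.Dec, M.Param s.1) (s : S) (a : A s) (s' : S) : ℝ :=
  if h : M.stage s < M.T ∧ M.stage s' = M.stage s + 1 then (x ⟨s, h.1⟩).1 (a, ⟨s', h.2⟩) else 0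

/-- The reward `r(s, a)`; the terminal reward is zero. -/
def reward (M : DAMDP S A) (x : ∀ s : M.Dec, M.Param s.1) (s : S) (a : A s) : ℝ :=
  if h : M.stage s < M.T then (x ⟨s, h⟩).2 a else 0

open Classical in
/-- The probability of the trajectory `(s₁, a₁, …, s_T, a_T)`. -/
def trajProb (M : DAMDP S A) (π : Rule A) (x : ∀ s : M.Dec, M.Param s.1)
    (τ : Fin M.T → Σ s, A s) : ℝ :=
  (if ∀ i : Fin M.T, (i : ℕ) = 0 → (τ i).1 = M.sIni then 1 else 0) *
    (∏ i : Fin M.T, π ((List.ofFn τ).take i) (τ i).1 (τ i).2) *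
    ∏ i : Fin M.T,
      if h : (i : ℕ) + 1 < M.T then M.trans x (τ i).1 (τ i).2 (τ ⟨i + 1, h⟩).1 else 1

/-- `u(π, p, r)`, the expected total discounted reward under fixed parameters. -/
def totalReward [Fintype S] [∀ s, Fintype (A s)] (M : DAMDP S A) (π : Rule A)
    (x : ∀ s : M.Dec, M.Param s.1) : ℝ :=
  ∑ τ : Fin M.T → Σ s, A s,
    M.trajProb π x τ * ∑ i : Fin M.T, M.γ ^ (i : ℕ) * M.reward x (τ i).1 (τ i).2

/-! ### Ambiguity sets -/

variable [Fintype S] [∀ s, Fintype (A s)]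

/-- The state-wise ambiguity set of distributions of `(p_s, r_s, ũ_s)`. The random vector `p_s`
consists of transition probabilities, almost surely. -/
def liftedAmbiguitySet (M : DAMDP S A) (s : M.Dec) : Set (Measure (M.LiftedParam s)) :=
  {μ | IsProbabilityMeasure μ ∧
    (∀ᵐ x ∂μ, ∀ a : A s.1, (fun s' => x.1 (a, s')) ∈ stdSimplex ℝ (M.Succ s.1)) ∧
    Integrable
      (fun x => (M.amb s).F *ᵥ x.1 + (M.amb s).G *ᵥ x.2.1 + (M.amb s).H *ᵥ x.2.2) μ ∧
    ∫ x, ((M.amb s).F *ᵥ x.1 + (M.amb s).G *ᵥ x.2.1 + (M.amb s).H *ᵥ x.2.2) ∂μ = (M.amb s).c ∧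
    ∀ i, μ.real ((M.amb s).O i) ∈ Set.Icc ((M.amb s).lo i) ((M.amb s).hi i)}

/-- The set of the marginal distributions of `(p_s, r_s)`. -/
def ambiguitySet (M : DAMDP S A) (s : M.Dec) : Set (Measure (M.Param s.1)) :=
  (fun μ => μ.map (fun x => (x.1, x.2.1))) '' M.liftedAmbiguitySet s

/-- The set of the product distributions of all `(p_s, r_s, ũ_s)`. -/
def liftedProductSet (M : DAMDP S A) : Set (Measure (∀ s : M.Dec, M.LiftedParam s)) :=
  {μ | ∃ ν : ∀ s : M.Dec, Measure (M.LiftedParam s),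
    (∀ s, ν s ∈ M.liftedAmbiguitySet s) ∧ μ = Measure.pi ν}

/-- The ambiguity set of the process: the marginal distributions of `(p, r)`. -/
def productSet (M : DAMDP S A) : Set (Measure (∀ s : M.Dec, M.Param s.1)) :=
  (fun μ => μ.map (fun x s => ((x s).1, (x s).2.1))) '' M.liftedProductSet

/-- `w(π, μ, sIni)`, the expected performance. -/
def performance (M : DAMDP S A) (π : Rule A) (μ : Measure (∀ s : M.Dec, M.Param s.1)) : ℝ :=
  ∫ x, M.totalReward π x ∂μ

/-- `π` is distributionally robust. The infima are taken in the extended reals. -/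
def IsDistributionallyRobust (M : DAMDP S A) (π : Rule A) : Prop :=
  π ∈ strategies A ∧ ∀ π' ∈ strategies A,
    ⨅ μ ∈ M.productSet, (M.performance π' μ : EReal) ≤
      ⨅ μ ∈ M.productSet, (M.performance π μ : EReal)

/-! ### S-robust strategies -/

/-- The expectation of `r(s, a) + γ v(s')` under the distribution `μ` of the parameters of `s`,
when the action `a` is drawn from `q` and `s'` is the next state. -/
def stageReward (M : DAMDP S A) (s : S) (v : M.Succ s → ℝ) (q : A s → ℝ)
    (μ : Measure (M.Param s)) : ℝ :=
  ∫ x, ∑ a, q a * (x.2 a + M.γ * ∑ s', x.1 (a, s') * v s') ∂μ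

/-- The worst case of `stageReward` over the ambiguity set of the state. -/
def worstStageReward (M : DAMDP S A) (s : M.Dec) (v : M.Succ s.1 → ℝ) (q : A s.1 → ℝ) : ℝ :=
  ⨅ μ : M.ambiguitySet s, M.stageReward s.1 v q μ

/-- The S-robust value, by backward induction from the value `0` at the terminal stage. -/
def robustValue (M : DAMDP S A) (s : S) : ℝ :=
  if h : M.stage s < M.T then
    ⨆ q : stdSimplex ℝ (A s), M.worstStageReward ⟨s, h⟩ (fun s' => robustValue M s'.1) q
  else 0
termination_by M.T - M.stage s
decreasing_by
  have : M.stage s'.1 = M.stage s + 1 := s'.2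
  omega

/-- `q` is an S-robust action at `s`: it is a maximizer over the simplex of the worst case. -/
def IsRobustAction (M : DAMDP S A) (s : M.Dec) (q : A s.1 → ℝ) : Prop :=
  IsMaxOn (M.worstStageReward s (fun s' => M.robustValue s'.1)) (stdSimplex ℝ (A s.1)) q ∧
    q ∈ stdSimplex ℝ (A s.1)

/-- `π` is an S-robust strategy: after every history that ends at a state before the terminal
stage, it prescribes an S-robust action of that state. -/
def IsSRobust (M : DAMDP S A) (π : Rule A) : Prop :=
  π ∈ strategies A ∧ ∀ (s : M.Dec) (h : List (Σ s, A s)), M.IsHistory h s.1 →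
    M.IsRobustAction s (π h s.1)

end DAMDP

end

/-! A strategy's performance depends on a product distribution only through the mean parameters of
each state. What happens after a state depends only on parameters of later stages, which are
independent of those of the state itself, so expectations pass through the backward recursion
(`integral_rewardToGo`). Each state thus poses a zero-sum game between an action and a mean vector,
with payoff linear in each.

The main difficulty is that the set of means is compact: in a weak limit, mass may drift onto the
boundary of a closed confidence set and violate its upper bound. The space is therefore cut into
cells according to membership in the confidence sets. Conditional means of cells lie in closed
convex intersections, so cell weights and means range over a compact set. Conversely, a point of
such an intersection may lie in too many confidence sets, but nesting lets it be split into two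
points with exactly the right memberships, along a reward direction that leaves the transitions
alone (`exists_segment_memPattern_eq`). Hence `isCompact_image_integral_momentMeasures`.

Sion's theorem now yields at each state a distribution that is worst against all actions at once
(`exists_worst_mean`). The product of these holds every strategy down to the robust value of the
initial state (`rewardToGo_le_robustValue`), while an S-robust strategy secures that value against
every product (`robustValue_le_rewardToGo`). -/

noncomputable section

open Set Filter Topology

/-! ### Membership patterns of nested families along lines -/

section Cells

variable {ι V : Type*}

/-- The indices of the sets of the family `O` that contain `x`. -/
def memPattern (O : ι → Set V) (x : V) : Set ι := {i | x ∈ O i}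

theorem preimage_memPattern [Finite ι] (O : ι → Set V) (J : Set ι) :
    memPattern O ⁻¹' {J} = ⋂ i, {x | x ∈ O i ↔ i ∈ J} := by
  ext x
  simp [memPattern, Set.ext_iff]

theorem measurableSet_preimage_memPattern [Finite ι] [MeasurableSpace V] {O : ι → Set V}
    (hO : ∀ i, MeasurableSet (O i)) (J : Set ι) : MeasurableSet (memPattern O ⁻¹' {J}) := by
  rw [preimage_memPattern]
  refine MeasurableSet.iInter fun i => ?_
  by_cases h : i ∈ J
  · simpa [h] using hO i
  · have hi : {x | x ∈ O i ↔ i ∈ J} = (O i)ᶜ := by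
      ext x
      simp [h]
    exact hi ▸ (hO i).compl

variable [NormedAddCommGroup V] [NormedSpace ℝ V]

/-- A ray that starts in the intersection of the sets of a realised pattern meets a point with
exactly this pattern, provided the family is nested and one of the sets is bounded. -/
theorem exists_ray_memPattern_eq [Finite ι] {O : ι → Set V} (hcl : ∀ i, IsClosed (O i))
    (hnest : ∀ i j, i ≠ j → O i ⊆ interior (O j) ∨ O j ⊆ interior (O i) ∨ Disjoint (O i) (O j))
    {J : Set ι} {x₀ : V} (hx₀ : memPattern O x₀ = J) {i₀ : ι} (hi₀ : i₀ ∈ J)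
    (hbdd : Bornology.IsBounded (O i₀)) {z : V} (hz : ∀ i ∈ J, z ∈ O i) {e : V} (he : e ≠ 0) :
    ∃ t : ℝ, 0 ≤ t ∧ memPattern O (z + t • e) = J := by
  have hcont : Continuous fun t : ℝ => z + t • e := by fun_prop
  set D : Set V := ⋂ i ∈ J, O i with hD
  have hDcl : IsClosed D := isClosed_biInter fun i _ => hcl i
  set R : Set ℝ := {t | 0 ≤ t ∧ z + t • e ∈ D} with hR
  have hRcl : IsClosed R := isClosed_Ici.inter (hDcl.preimage hcont)
  have hRbdd : BddAbove R := by
    obtain ⟨C, hC⟩ := hbdd.exists_norm_le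
    refine ⟨(C + ‖z‖) / ‖e‖, fun t ht => ?_⟩
    have h1 : ‖z + t • e‖ ≤ C := hC _ (mem_iInter₂.1 ht.2 i₀ hi₀)
    have h2 : ‖t • e‖ ≤ ‖z + t • e‖ + ‖z‖ := by
      simpa using norm_sub_le (z + t • e) z
    rw [norm_smul, Real.norm_of_nonneg ht.1] at h2
    rw [le_div_iff₀ (norm_pos_iff.2 he)]
    linarith
  have hRne : R.Nonempty := ⟨0, le_rfl, by simpa [hD] using hz⟩
  have hmem := hRcl.csSup_mem hRne hRbdd
  set t := sSup R
  have hyD : ∀ i ∈ J, z + t • e ∈ O i := fun i hi => mem_iInter₂.1 hmem.2 i hi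
  -- At the last parameter the point cannot be interior to all of the finitely many sets, since the
  -- ray would then stay inside a little longer.
  have hint : ¬ ∀ i ∈ J, z + t • e ∈ interior (O i) := by
    intro h
    have hnhds : D ∈ 𝓝 (z + t • e) :=
      (biInter_mem (toFinite J)).2 fun i hi => mem_interior_iff_mem_nhds.1 (h i hi)
    have h1 : ∀ᶠ u in 𝓝[>] t, z + u • e ∈ D :=
      (hcont.continuousAt.eventually_mem hnhds).filter_mono nhdsWithin_le_nhds
    obtain ⟨u, hu, hut⟩ := (h1.and self_mem_nhdsWithin).exists
    exact absurd (le_csSup hRbdd (show u ∈ R from ⟨hmem.1.trans (le_of_lt hut), hu⟩))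
      (not_le.2 hut)
  refine ⟨t, hmem.1, Subset.antisymm (fun k hk => ?_) hyD⟩
  by_contra hkJ
  refine hint fun i hi => ?_
  have hki : k ≠ i := fun h => hkJ (h ▸ hi)
  -- Only the first alternative survives: the second would put `k` into the pattern of `x₀`, and the
  -- third fails at the end point.
  rcases hnest k i hki with h | h | h
  · exact h hk
  · have hx : x₀ ∈ O i := by
      have : i ∈ memPattern O x₀ := hx₀ ▸ hi
      exact this
    have : k ∈ memPattern O x₀ := interior_subset (s := O k) (h hx)
    exact absurd (hx₀ ▸ this) hkJ
  · exact absurd (hyD i hi) (disjoint_left.1 h hk)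

/-- A point of the intersection of the sets of a realised pattern is a convex combination of two
points with this pattern on a line of prescribed direction. -/
theorem exists_segment_memPattern_eq [Finite ι] {O : ι → Set V} (hcl : ∀ i, IsClosed (O i))
    (hnest : ∀ i j, i ≠ j → O i ⊆ interior (O j) ∨ O j ⊆ interior (O i) ∨ Disjoint (O i) (O j))
    {J : Set ι} {x₀ : V} (hx₀ : memPattern O x₀ = J) {i₀ : ι} (hi₀ : i₀ ∈ J)
    (hbdd : Bornology.IsBounded (O i₀)) {z : V} (hz : ∀ i ∈ J, z ∈ O i) {e : V} (he : e ≠ 0) :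
    ∃ θ t t' : ℝ, 0 ≤ θ ∧ θ ≤ 1 ∧ memPattern O (z + t • e) = J ∧ memPattern O (z + t' • e) = J ∧
      θ • (z + t • e) + (1 - θ) • (z + t' • e) = z := by
  obtain ⟨t, ht, h1⟩ := exists_ray_memPattern_eq hcl hnest hx₀ hi₀ hbdd hz he
  obtain ⟨s, hs, h2⟩ := exists_ray_memPattern_eq hcl hnest hx₀ hi₀ hbdd hz (neg_ne_zero.2 he)
  rcases (add_nonneg ht hs).eq_or_lt with h | h
  -- Both rays stop at once, so `z` itself already has the pattern.
  · have : t = 0 := by linarith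
    exact ⟨1, t, t, zero_le_one, le_rfl, h1, h1, by simp [this]⟩
  · refine ⟨s / (t + s), t, -s, by positivity, (div_le_one h).2 (by linarith), h1,
      by simpa using h2, ?_⟩
    have h3 : s / (t + s) * t + (1 - s / (t + s)) * (-s) = 0 := by
      field_simp
      ring
    calc _ = z + (s / (t + s) * t + (1 - s / (t + s)) * (-s)) • e := by module
      _ = z := by rw [h3]; simp

end Cells

/-! ### Finitely supported distributions -/

section Discrete

variable {κ V : Type*} [Fintype κ] [MeasurableSpace V]

/-- The distribution with masses `w k` at the points `y k`. -/
def discreteMeasure (w : κ → ℝ) (y : κ → V) : Measure V :=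
  ∑ k, ENNReal.ofReal (w k) • Measure.dirac (y k)

theorem isProbabilityMeasure_discreteMeasure {w : κ → ℝ} (hw : w ∈ stdSimplex ℝ κ) (y : κ → V) :
    IsProbabilityMeasure (discreteMeasure w y) := by
  constructor
  simp only [discreteMeasure, Measure.coe_finsetSum, Finset.sum_apply, Measure.smul_apply,
    measure_univ, smul_eq_mul, mul_one]
  rw [← ENNReal.ofReal_sum_of_nonneg fun k _ => hw.1 k, hw.2, ENNReal.ofReal_one]

theorem ae_discreteMeasure (w : κ → ℝ) (y : κ → V) {s : Set V} (hs : MeasurableSet s)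
    (h : ∀ k, y k ∈ s) : ∀ᵐ x ∂discreteMeasure w y, x ∈ s := by
  rw [ae_iff]
  change discreteMeasure w y sᶜ = 0
  simp [discreteMeasure, hs.compl, h]

theorem integrable_discreteMeasure [MeasurableSingletonClass V] {E : Type*} [NormedAddCommGroup E]
    (w : κ → ℝ) (y : κ → V) (f : V → E) : Integrable f (discreteMeasure w y) := by
  refine integrable_finsetSum_measure.2 fun k _ => ?_
  exact (integrable_dirac (by simp)).smul_measure (by simp)

theorem integral_discreteMeasure [MeasurableSingletonClass V] {E : Type*} [NormedAddCommGroup E]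
    [NormedSpace ℝ E] [CompleteSpace E] {w : κ → ℝ} (hw : ∀ k, 0 ≤ w k) (y : κ → V) (f : V → E) :
    ∫ x, f x ∂discreteMeasure w y = ∑ k, w k • f (y k) := by
  rw [discreteMeasure, integral_finsetSum_measure fun k _ =>
    (integrable_dirac (by simp)).smul_measure (by simp)]
  simp [integral_smul_measure, ENNReal.toReal_ofReal (hw _)]

open Classical in
theorem discreteMeasure_real {w : κ → ℝ} (hw : ∀ k, 0 ≤ w k) (y : κ → V) {s : Set V}
    (hs : MeasurableSet s) :
    (discreteMeasure w y).real s = ∑ k, if y k ∈ s then w k else 0 := by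
  simp only [Measure.real, discreteMeasure, Measure.coe_finsetSum, Finset.sum_apply,
    Measure.smul_apply, smul_eq_mul, Measure.dirac_apply' _ hs]
  rw [ENNReal.toReal_sum fun k _ => by
    by_cases h : y k ∈ s <;> simp [h]]
  refine Finset.sum_congr rfl fun k _ => ?_
  by_cases h : y k ∈ s <;> simp [h, hw k]

end Discrete

/-! ### Compactness and convexity of the set of means -/

section Moment

variable {ι V W : Type*} [NormedAddCommGroup V] [NormedSpace ℝ V] [MeasurableSpace V]
  [NormedAddCommGroup W] [NormedSpace ℝ W]

/-- The probability distributions on `P` with `E[L x] = c` that give `O i` a probability between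
`lo i` and `hi i`. -/
def momentMeasures (O : ι → Set V) (P : Set V) (lo hi : ι → ℝ) (L : V → W) (c : W) :
    Set (Measure V) :=
  {μ | IsProbabilityMeasure μ ∧ (∀ᵐ x ∂μ, x ∈ P) ∧ Integrable L μ ∧ ∫ x, L x ∂μ = c ∧
    ∀ i, μ.real (O i) ∈ Icc (lo i) (hi i)}

/-- The patterns that contain `i₀` and occur in `P`. -/
abbrev RealisedPattern (O : ι → Set V) (P : Set V) (i₀ : ι) : Type _ :=
  {J : Set ι // i₀ ∈ J ∧ ∃ x ∈ P, memPattern O x = J}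

open Classical in
/-- The pairs of weights and conditional means of the cells of a distribution in
`momentMeasures`. -/
def cellMoments [Fintype ι] (O : ι → Set V) (P : Set V) (i₀ : ι) (lo hi : ι → ℝ) (L : V →L[ℝ] W)
    (c : W) : Set ((RealisedPattern O P i₀ → ℝ) × (RealisedPattern O P i₀ → V)) :=
  {p | p.1 ∈ stdSimplex ℝ _ ∧ (∀ J, p.2 J ∈ P ∩ ⋂ i ∈ J.1, O i) ∧
    L (∑ J, p.1 J • p.2 J) = c ∧
    ∀ i, (∑ J : RealisedPattern O P i₀, if i ∈ J.1 then p.1 J else 0) ∈ Icc (lo i) (hi i)}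

variable {O : ι → Set V} {P : Set V} {i₀ : ι} {lo hi : ι → ℝ} {L : V →L[ℝ] W} {c : W}

/-- The points are only required to lie in the sets of their pattern, not to avoid the others; this
keeps the condition closed. Boundedness comes from `i₀` belonging to every pattern. -/
theorem isCompact_cellMoments [Fintype ι] [FiniteDimensional ℝ V] (hcl : ∀ i, IsClosed (O i))
    (hP : IsClosed P) (hbdd : Bornology.IsBounded (O i₀)) :
    IsCompact (cellMoments O P i₀ lo hi L c) := by
  classical
  have := FiniteDimensional.proper ℝ V
  have hK : IsCompact (stdSimplex ℝ (RealisedPattern O P i₀) ×ˢ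
      Set.pi univ fun J : RealisedPattern O P i₀ => P ∩ ⋂ i ∈ J.1, O i) := by
    refine (isCompact_stdSimplex ℝ _).prod (isCompact_univ_pi fun J => ?_)
    refine Metric.isCompact_of_isClosed_isBounded
      (hP.inter (isClosed_biInter fun i _ => hcl i)) (hbdd.subset fun x hx => ?_)
    exact mem_iInter₂.1 hx.2 i₀ J.2.1
  refine hK.of_isClosed_subset ?_ fun p hp => ⟨hp.1, fun J _ => hp.2.1 J⟩
  have h1 : cellMoments O P i₀ lo hi L c = (stdSimplex ℝ (RealisedPattern O P i₀) ×ˢ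
      Set.pi univ fun J : RealisedPattern O P i₀ => P ∩ ⋂ i ∈ J.1, O i) ∩
      ({p | L (∑ J, p.1 J • p.2 J) = c} ∩ ⋂ i, {p |
        (∑ J : RealisedPattern O P i₀, if i ∈ J.1 then p.1 J else 0) ∈ Icc (lo i) (hi i)}) := by
    ext p
    simp only [cellMoments, mem_ofPred_eq, mem_inter_iff, mem_prod, mem_univ_pi, mem_iInter]
    tauto
  rw [h1]
  refine hK.isClosed.inter ((isClosed_eq (by fun_prop) continuous_const).inter
    (isClosed_iInter fun i => isClosed_Icc.preimage ?_))
  refine continuous_finsetSum _ fun J _ => ?_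
  by_cases h : i ∈ J.1
  · simpa [h] using by fun_prop
  · simpa [h] using continuous_const

theorem integral_ofReal_smul_add {μ ν : Measure V} {a b : ℝ} (ha : 0 ≤ a) (hb : 0 ≤ b) {f : V → W}
    (hμ : Integrable f μ) (hν : Integrable f ν) :
    ∫ x, f x ∂(ENNReal.ofReal a • μ + ENNReal.ofReal b • ν) =
      a • ∫ x, f x ∂μ + b • ∫ x, f x ∂ν := by
  rw [integral_add_measure (hμ.smul_measure (by simp)) (hν.smul_measure (by simp)),
    integral_smul_measure, integral_smul_measure, ENNReal.toReal_ofReal ha,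
    ENNReal.toReal_ofReal hb]

variable [BorelSpace V] [FiniteDimensional ℝ V]

theorem integrable_id_of_ae_mem_isBounded {μ : Measure V} [IsFiniteMeasure μ] {s : Set V}
    (hs : Bornology.IsBounded s) (h : ∀ᵐ x ∂μ, x ∈ s) : Integrable (fun x : V => x) μ := by
  obtain ⟨C, hC⟩ := hs.exists_norm_le
  exact Integrable.of_bound aestronglyMeasurable_id C (h.mono fun x hx => hC x hx)

theorem ae_mem_of_mem_momentMeasures {L : V → W} (hcl : ∀ i, IsClosed (O i)) (hlo : lo i₀ = 1)
    {μ : Measure V} (hμ : μ ∈ momentMeasures O P lo hi L c) : ∀ᵐ x ∂μ, x ∈ O i₀ := by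
  have := hμ.1
  have h : μ.real (O i₀) = 1 := le_antisymm measureReal_le_one (hlo ▸ (hμ.2.2.2.2 i₀).1)
  exact (mem_ae_iff_prob_eq_one (hcl i₀).measurableSet).2 ((ENNReal.toReal_eq_one_iff _).1 h)

open Classical in
-- Disintegrate over the cells: a conditional mean may leave its cell, but not the closed convex set
-- `P ∩ ⋂ i ∈ J, O i`.
theorem integral_mem_image_cellMoments [Fintype ι] [CompleteSpace W] (hcl : ∀ i, IsClosed (O i))
    (hcv : ∀ i, Convex ℝ (O i)) (hPcl : IsClosed P) (hPcv : Convex ℝ P)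
    (hbdd : Bornology.IsBounded (O i₀)) (hlo : lo i₀ = 1)
    {μ : Measure V} (hμ : μ ∈ momentMeasures O P lo hi L c) :
    ∫ x, x ∂μ ∈ (fun p => ∑ J, p.1 J • p.2 J) '' cellMoments O P i₀ lo hi L c := by
  have hprob := hμ.1
  have hae := ae_mem_of_mem_momentMeasures hcl hlo hμ
  have hint := integrable_id_of_ae_mem_isBounded hbdd hae
  set cell : RealisedPattern O P i₀ → Set V := fun J => memPattern O ⁻¹' {J.1} with hcell
  have hmeas : ∀ J, MeasurableSet (cell J) := fun J =>
    measurableSet_preimage_memPattern (fun i => (hcl i).measurableSet) _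
  have hdisj : Pairwise (Function.onFun Disjoint cell) := fun J J' h =>
    disjoint_left.2 fun x (hx : memPattern O x = J.1) (hx' : memPattern O x = J'.1) =>
      h (Subtype.ext (hx.symm.trans hx'))
  have hcov : ∀ᵐ x ∂μ, x ∈ ⋃ J, cell J := by
    filter_upwards [hμ.2.1, hae] with x hxP hx
    exact mem_iUnion.2 ⟨⟨memPattern O x, hx, x, hxP, rfl⟩, rfl⟩
  have hex : ∀ J : RealisedPattern O P i₀, ∃ z ∈ P ∩ ⋂ i ∈ J.1, O i,
      μ.real (cell J) • z = ∫ x in cell J, x ∂μ := by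
    intro J
    -- A null cell has no conditional mean; any point realising the pattern serves instead.
    by_cases h0 : μ (cell J) = 0
    · obtain ⟨x, hxP, hx⟩ := J.2.2
      refine ⟨x, ⟨hxP, mem_iInter₂.2 fun i hi => ?_⟩, ?_⟩
      · rw [← hx] at hi
        exact hi
      · simp [Measure.real, h0, Measure.restrict_eq_zero.2 h0]
    · refine ⟨⨍ x in cell J, x ∂μ, ?_, measure_smul_setAverage _ (measure_ne_top _ _)⟩
      refine (hPcv.inter (convex_iInter₂ fun i _ => hcv i)).set_average_mem
        (hPcl.inter (isClosed_biInter fun i _ => hcl i)) h0 (measure_ne_top _ _) ?_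
        hint.integrableOn
      filter_upwards [ae_restrict_of_ae hμ.2.1, ae_restrict_mem (hmeas J)] with x hxP hx
      refine ⟨hxP, mem_iInter₂.2 fun i hi => ?_⟩
      rw [← show memPattern O x = J.1 from hx] at hi
      exact hi
  choose z hz hzint using hex
  have hsum : ∑ J, μ.real (cell J) • z J = ∫ x, x ∂μ := by
    simp_rw [hzint]
    rw [← integral_iUnion_fintype hmeas hdisj fun J => hint.integrableOn,
      Measure.restrict_eq_self_of_ae_mem hcov]
  have hmass : ∀ i, (∑ J : RealisedPattern O P i₀, if i ∈ J.1 then μ.real (cell J) else 0) =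
      μ.real (O i) := by
    intro i
    have h1 : μ.real (O i) = μ.real (⋃ J ∈ Finset.univ.filter
        fun J : RealisedPattern O P i₀ => i ∈ J.1, cell J) := by
      refine measureReal_congr ?_
      filter_upwards [hcov] with x hx
      obtain ⟨J, hJ⟩ := mem_iUnion.1 hx
      refine propext ⟨fun hxi => mem_iUnion₂.2 ⟨J, Finset.mem_filter.2 ⟨Finset.mem_univ _, ?_⟩, hJ⟩,
        fun hxi => ?_⟩
      · rw [← show memPattern O x = J.1 from hJ]
        exact hxi
      · obtain ⟨J', hJ', hx'⟩ := mem_iUnion₂.1 hxi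
        have hi := (Finset.mem_filter.1 hJ').2
        rw [← show memPattern O x = J'.1 from hx'] at hi
        exact hi
    rw [h1, measureReal_biUnion_finset (fun J _ J' _ h => hdisj h) (fun J _ => hmeas J)
        (fun J _ => measure_ne_top _ _),
      Finset.sum_filter]
  refine ⟨(fun J => μ.real (cell J), z), ⟨⟨fun J => measureReal_nonneg, ?_⟩, hz, ?_, ?_⟩, hsum⟩
  · have h := hmass i₀
    rw [Finset.sum_congr rfl fun J _ => if_pos J.2.1] at h
    rw [h]
    exact le_antisymm measureReal_le_one (hlo ▸ (hμ.2.2.2.2 i₀).1)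
  · change L (∑ J, μ.real (cell J) • z J) = c
    rw [hsum, ← L.integral_comp_comm hint, hμ.2.2.2.1]
  · intro i
    rw [hmass i]
    exact hμ.2.2.2.2 i

open Classical in
-- Replacing each point by two points with its exact pattern and the same barycentre keeps the mean
-- and makes the probability of each `O i` the sum of the prescribed weights. Invariance of `P`
-- under `e` keeps the new points in `P`.
theorem exists_momentMeasures_of_mem_cellMoments [Fintype ι] [CompleteSpace W] (hcl : ∀ i, IsClosed (O i))
    (hnest : ∀ i j, i ≠ j → O i ⊆ interior (O j) ∨ O j ⊆ interior (O i) ∨ Disjoint (O i) (O j))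
    (hPcl : IsClosed P) (hbdd : Bornology.IsBounded (O i₀)) {e : V} (he : e ≠ 0)
    (hPe : ∀ x ∈ P, ∀ t : ℝ, x + t • e ∈ P)
    {p : (RealisedPattern O P i₀ → ℝ) × (RealisedPattern O P i₀ → V)}
    (hp : p ∈ cellMoments O P i₀ lo hi L c) :
    ∃ μ ∈ momentMeasures O P lo hi L c, ∫ x, x ∂μ = ∑ J, p.1 J • p.2 J := by
  obtain ⟨hw, hz, hL, hprob⟩ := hp
  have hsplit : ∀ J : RealisedPattern O P i₀, ∃ θ t t' : ℝ, 0 ≤ θ ∧ θ ≤ 1 ∧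
      memPattern O (p.2 J + t • e) = J.1 ∧ memPattern O (p.2 J + t' • e) = J.1 ∧
      θ • (p.2 J + t • e) + (1 - θ) • (p.2 J + t' • e) = p.2 J := fun J => by
    obtain ⟨x, _, hx⟩ := J.2.2
    exact exists_segment_memPattern_eq hcl hnest hx J.2.1 hbdd
      (fun i hi => mem_iInter₂.1 (hz J).2 i hi) he
  choose θ t t' hθ0 hθ1 h1 h2 h3 using hsplit
  set w : RealisedPattern O P i₀ × Bool → ℝ := fun k =>
    p.1 k.1 * if k.2 then θ k.1 else 1 - θ k.1 with hwdef
  set y : RealisedPattern O P i₀ × Bool → V := fun k =>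
    p.2 k.1 + (if k.2 then t k.1 else t' k.1) • e with hydef
  have hw0 : ∀ k, 0 ≤ w k := by
    rintro ⟨J, _ | _⟩
    · exact mul_nonneg (hw.1 J) (sub_nonneg.2 (hθ1 J))
    · exact mul_nonneg (hw.1 J) (hθ0 J)
  have hwsum : w ∈ stdSimplex ℝ _ := by
    refine ⟨hw0, ?_⟩
    rw [Fintype.sum_prod_type, ← hw.2]
    refine Finset.sum_congr rfl fun J _ => ?_
    simp [hwdef]
    ring
  have hy : ∀ k i, y k ∈ O i ↔ i ∈ k.1.1 := by
    rintro ⟨J, _ | _⟩ i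
    · rw [← h2 J]; rfl
    · rw [← h1 J]; rfl
  have hmean : ∑ k, w k • y k = ∑ J, p.1 J • p.2 J := by
    rw [Fintype.sum_prod_type]
    refine Finset.sum_congr rfl fun J _ => ?_
    conv_rhs => rw [← h3 J]
    simp [hwdef, hydef, mul_smul]
  refine ⟨discreteMeasure w y, ⟨isProbabilityMeasure_discreteMeasure hwsum y,
    ae_discreteMeasure w y hPcl.measurableSet fun k => hPe _ (hz k.1).1 _,
    integrable_discreteMeasure w y _, ?_, fun i => ?_⟩, ?_⟩
  · rw [integral_discreteMeasure hw0, ← hL, ← hmean, map_sum]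
    simp
  · rw [discreteMeasure_real hw0 _ (hcl i).measurableSet, Fintype.sum_prod_type]
    refine (Finset.sum_congr rfl fun J _ => ?_ : _ = ∑ J : RealisedPattern O P i₀,
      if i ∈ J.1 then p.1 J else 0) ▸ hprob i
    by_cases h : i ∈ J.1
    · simp [hy, h, hwdef]
      ring
    · simp [hy, h]
  · rw [integral_discreteMeasure hw0, hmean]

theorem convex_image_integral_momentMeasures {s : Set V} (hs : Bornology.IsBounded s)
    (hae : ∀ μ ∈ momentMeasures O P lo hi L c, ∀ᵐ x ∂μ, x ∈ s) :
    Convex ℝ ((fun μ => ∫ x, x ∂μ) '' momentMeasures O P lo hi L c) := by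
  rintro _ ⟨μ, hμ, rfl⟩ _ ⟨ν, hν, rfl⟩ a b ha hb hab
  have hμp := hμ.1
  have hνp := hν.1
  have hμi := integrable_id_of_ae_mem_isBounded hs (hae μ hμ)
  have hνi := integrable_id_of_ae_mem_isBounded hs (hae ν hν)
  refine ⟨ENNReal.ofReal a • μ + ENNReal.ofReal b • ν, ⟨⟨?_⟩, ?_, ?_, ?_, fun i => ?_⟩,
    integral_ofReal_smul_add ha hb hμi hνi⟩
  · simp [← ENNReal.ofReal_add ha hb, hab]
  · rw [ae_add_measure_iff]
    exact ⟨Measure.ae_smul_measure hμ.2.1 _, Measure.ae_smul_measure hν.2.1 _⟩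
  · exact (hμ.2.2.1.smul_measure (by simp)).add_measure (hν.2.2.1.smul_measure (by simp))
  · rw [integral_ofReal_smul_add ha hb hμ.2.2.1 hν.2.2.1, hμ.2.2.2.1, hν.2.2.2.1, ← add_smul, hab, one_smul]
  · have h : (ENNReal.ofReal a • μ + ENNReal.ofReal b • ν).real (O i) =
        a * μ.real (O i) + b * ν.real (O i) := by
      rw [Measure.real, Measure.add_apply, Measure.smul_apply, Measure.smul_apply, smul_eq_mul,
        smul_eq_mul, ENNReal.toReal_add (by finiteness) (by finiteness)]
      simp [Measure.real, ha, hb]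
    rw [h]
    exact convex_Icc _ _ (hμ.2.2.2.2 i) (hν.2.2.2.2 i) ha hb hab

theorem isCompact_image_integral_momentMeasures [Fintype ι] [CompleteSpace W] (hcl : ∀ i, IsClosed (O i))
    (hcv : ∀ i, Convex ℝ (O i))
    (hnest : ∀ i j, i ≠ j → O i ⊆ interior (O j) ∨ O j ⊆ interior (O i) ∨ Disjoint (O i) (O j))
    (hPcl : IsClosed P) (hPcv : Convex ℝ P) (hbdd : Bornology.IsBounded (O i₀)) (hlo : lo i₀ = 1)
    {e : V} (he : e ≠ 0) (hPe : ∀ x ∈ P, ∀ t : ℝ, x + t • e ∈ P) :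
    IsCompact ((fun μ => ∫ x, x ∂μ) '' momentMeasures O P lo hi L c) := by
  classical
  have h : (fun μ => ∫ x, x ∂μ) '' momentMeasures O P lo hi L c =
      (fun p => ∑ J, p.1 J • p.2 J) '' cellMoments O P i₀ lo hi L c := by
    refine Subset.antisymm ?_ ?_
    · rintro _ ⟨μ, hμ, rfl⟩
      exact integral_mem_image_cellMoments hcl hcv hPcl hPcv hbdd hlo hμ
    · rintro _ ⟨p, hp, rfl⟩
      exact exists_momentMeasures_of_mem_cellMoments hcl hnest hPcl hbdd he hPe hp
  rw [h]
  exact (isCompact_cellMoments hcl hPcl hbdd).image (by fun_prop)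

end Moment

/-! ### State-wise ambiguity sets and their means -/

theorem AmbiguityData.isClosed_conicSet {X Y : Type*} [Fintype X] [Fintype Y] {Q L : ℕ}
    (B : Matrix (Fin L) X ℝ) (R : Matrix (Fin L) Y ℝ) (E : Matrix (Fin L) (Fin Q) ℝ)
    (b : Fin L → ℝ) {K : ConvexCone ℝ (Fin L → ℝ)} (hK : IsClosed (K : Set (Fin L → ℝ))) :
    IsClosed (AmbiguityData.conicSet B R E b K : Set (Lifted X Y Q)) :=
  hK.preimage (f := fun x : Lifted X Y Q => b - (B *ᵥ x.1 + R *ᵥ x.2.1 + E *ᵥ x.2.2)) (by fun_prop)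

theorem AmbiguityData.ConicRepresentable.isClosed {X Y : Type*} [Fintype X] [Fintype Y]
    {D : AmbiguityData X Y} (h : D.ConicRepresentable) (i : Fin (D.m + 1)) : IsClosed (D.O i) := by
  obtain ⟨_, _, L, B, R, E, b, K, hK, hO⟩ := h i
  rw [hO]
  exact AmbiguityData.isClosed_conicSet B R E b hK.1

/-- The map `(p, r, ũ) ↦ F p + G r + H ũ`. -/
def AmbiguityData.momentMap {X Y : Type*} [Fintype X] [Fintype Y] (D : AmbiguityData X Y) :
    Lifted X Y D.Q →L[ℝ] (Fin D.k → ℝ) :=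
  LinearMap.toContinuousLinearMap
    (D.F.mulVecLin ∘ₗ LinearMap.fst ℝ _ _ +
      D.G.mulVecLin ∘ₗ LinearMap.fst ℝ _ _ ∘ₗ LinearMap.snd ℝ _ _ +
      D.H.mulVecLin ∘ₗ LinearMap.snd ℝ _ _ ∘ₗ LinearMap.snd ℝ _ _)

namespace DAMDP

variable {S : Type*} [Fintype S] {A : S → Type*} [∀ s, Fintype (A s)] (M : DAMDP S A)

/-- The vectors `p` whose rows are transition probabilities. -/
def stochasticSet (s : S) : Set (A s × M.Succ s → ℝ) :=
  {p | ∀ a, (fun s' => p (a, s')) ∈ stdSimplex ℝ (M.Succ s)}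

theorem isClosed_stochasticSet (s : S) : IsClosed (M.stochasticSet s) := by
  simp only [stochasticSet, ofPred_forall]
  exact isClosed_iInter fun a => (isClosed_stdSimplex ℝ _).preimage (by fun_prop)

theorem convex_stochasticSet (s : S) : Convex ℝ (M.stochasticSet s) :=
  fun _ hp _ hp' _ _ ha hb hab a => convex_stdSimplex ℝ _ (hp a) (hp' a) ha hb hab

/-- The first two components of a lifted parameter vector. -/
def paramProj (s : M.Dec) : M.LiftedParam s →L[ℝ] M.Param s.1 :=
  (ContinuousLinearMap.fst ℝ _ _).prod
    (ContinuousLinearMap.fst ℝ _ _ ∘L ContinuousLinearMap.snd ℝ _ _)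

theorem liftedAmbiguitySet_eq_momentMeasures (s : M.Dec) :
    M.liftedAmbiguitySet s = momentMeasures (M.amb s).O (Prod.fst ⁻¹' M.stochasticSet s.1)
      (M.amb s).lo (M.amb s).hi (M.amb s).momentMap (M.amb s).c := rfl

theorem ambiguitySet_eq_image (s : M.Dec) :
    M.ambiguitySet s = (fun μ => μ.map (M.paramProj s)) '' M.liftedAmbiguitySet s := rfl

/-- Coordinatewise projection commutes with products, so the auxiliary vectors can be forgotten
state by state. -/
theorem productSet_eq :
    M.productSet = {μ | ∃ η : ∀ s : M.Dec, Measure (M.Param s.1),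
      (∀ s, η s ∈ M.ambiguitySet s) ∧ μ = Measure.pi η} := by
  have key : ∀ ν : ∀ s : M.Dec, Measure (M.LiftedParam s), (∀ s, ν s ∈ M.liftedAmbiguitySet s) →
      (Measure.pi ν).map (fun x s => M.paramProj s (x s)) =
        Measure.pi fun s => (ν s).map (M.paramProj s) := fun ν hν => by
    have (s : M.Dec) : IsProbabilityMeasure (ν s) := (hν s).1
    have (s : M.Dec) : IsProbabilityMeasure ((ν s).map (M.paramProj s)) :=
      Measure.isProbabilityMeasure_map (M.paramProj s).continuous.measurable.aemeasurable
    exact Measure.pi_map_pi fun s => (M.paramProj s).continuous.measurable.aemeasurable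
  ext μ
  constructor
  · rintro ⟨_, ⟨ν, hν, rfl⟩, rfl⟩
    exact ⟨_, fun s => ⟨ν s, hν s, rfl⟩, key ν hν⟩
  · rintro ⟨η, hη, rfl⟩
    choose ν hν hνη using hη
    refine ⟨_, ⟨ν, hν, rfl⟩, (key ν hν).trans ?_⟩
    congr
    exact funext hνη

variable {M}

theorem isProbabilityMeasure_of_mem_ambiguitySet {s : M.Dec} {η : Measure (M.Param s.1)}
    (hη : η ∈ M.ambiguitySet s) : IsProbabilityMeasure η := by
  obtain ⟨ν, hν, rfl⟩ := hη
  have := hν.1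
  exact Measure.isProbabilityMeasure_map (M.paramProj s).continuous.measurable.aemeasurable

theorem ae_stochastic_of_mem_ambiguitySet {s : M.Dec} {η : Measure (M.Param s.1)}
    (hη : η ∈ M.ambiguitySet s) : ∀ᵐ x ∂η, x.1 ∈ M.stochasticSet s.1 := by
  obtain ⟨ν, hν, rfl⟩ := hη
  refine (ae_map_iff (M.paramProj s).continuous.measurable.aemeasurable ?_).2 hν.2.1
  exact ((M.isClosed_stochasticSet s.1).preimage continuous_fst).measurableSet

theorem exists_isCompact_ae_mem {s : M.Dec} (hcl : ∀ i, IsClosed ((M.amb s).O i))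
    (hbdd : (M.amb s).BoundedSupport) :
    ∃ K : Set (M.Param s.1), IsCompact K ∧ ∀ η ∈ M.ambiguitySet s, ∀ᵐ x ∂η, x ∈ K := by
  have hK : IsCompact ((M.paramProj s) '' (M.amb s).O (Fin.last _)) :=
    (Metric.isCompact_of_isClosed_isBounded (hcl _) hbdd.1).image (M.paramProj s).continuous
  refine ⟨_, hK, ?_⟩
  rintro _ ⟨ν, hν, rfl⟩
  refine (ae_map_iff (M.paramProj s).continuous.measurable.aemeasurable hK.measurableSet).2 ?_
  filter_upwards [ae_mem_of_mem_momentMeasures (i₀ := Fin.last _) hcl hbdd.2.1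
    (M.liftedAmbiguitySet_eq_momentMeasures s ▸ hν)] with x hx
  exact mem_image_of_mem _ hx

theorem integrable_of_mem_ambiguitySet {s : M.Dec} (hcl : ∀ i, IsClosed ((M.amb s).O i))
    (hbdd : (M.amb s).BoundedSupport) {η : Measure (M.Param s.1)} (hη : η ∈ M.ambiguitySet s) :
    Integrable (fun x => x) η := by
  have := isProbabilityMeasure_of_mem_ambiguitySet hη
  obtain ⟨K, hK, h⟩ := exists_isCompact_ae_mem hcl hbdd
  exact integrable_id_of_ae_mem_isBounded hK.isBounded (h η hη)

theorem integral_stochastic_of_mem_ambiguitySet {s : M.Dec} (hcl : ∀ i, IsClosed ((M.amb s).O i))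
    (hbdd : (M.amb s).BoundedSupport) {η : Measure (M.Param s.1)} (hη : η ∈ M.ambiguitySet s) :
    (∫ x, x ∂η).1 ∈ M.stochasticSet s.1 := by
  have := isProbabilityMeasure_of_mem_ambiguitySet hη
  have hcv : Convex ℝ {x : M.Param s.1 | x.1 ∈ M.stochasticSet s.1} :=
    (M.convex_stochasticSet s.1).linear_preimage (LinearMap.fst ℝ _ _)
  have hclosed : IsClosed {x : M.Param s.1 | x.1 ∈ M.stochasticSet s.1} :=
    (M.isClosed_stochasticSet s.1).preimage continuous_fst
  exact hcv.integral_mem hclosed (ae_stochastic_of_mem_ambiguitySet hη) (integrable_of_mem_ambiguitySet hcl hbdd hη)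

theorem integral_map_paramProj {s : M.Dec} (hcl : ∀ i, IsClosed ((M.amb s).O i))
    (hbdd : (M.amb s).BoundedSupport) {ν : Measure (M.LiftedParam s)}
    (hν : ν ∈ M.liftedAmbiguitySet s) :
    ∫ x, x ∂(ν.map (M.paramProj s)) = M.paramProj s (∫ x, x ∂ν) := by
  have := hν.1
  have hint := integrable_id_of_ae_mem_isBounded hbdd.1
    (ae_mem_of_mem_momentMeasures (i₀ := Fin.last _) hcl hbdd.2.1
      (M.liftedAmbiguitySet_eq_momentMeasures s ▸ hν))
  rw [integral_map (f := fun x => x) (M.paramProj s).continuous.measurable.aemeasurable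
    aestronglyMeasurable_id, ContinuousLinearMap.integral_comp_comm _ hint]

theorem image_integral_ambiguitySet {s : M.Dec} (hcl : ∀ i, IsClosed ((M.amb s).O i))
    (hbdd : (M.amb s).BoundedSupport) :
    (fun η => ∫ x, x ∂η) '' M.ambiguitySet s =
      M.paramProj s '' ((fun ν => ∫ x, x ∂ν) '' M.liftedAmbiguitySet s) := by
  rw [ambiguitySet_eq_image, image_image, image_image]
  exact image_congr fun ν hν => integral_map_paramProj hcl hbdd hν

theorem convex_image_integral_ambiguitySet {s : M.Dec} (hcl : ∀ i, IsClosed ((M.amb s).O i))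
    (hbdd : (M.amb s).BoundedSupport) :
    Convex ℝ ((fun η => ∫ x, x ∂η) '' M.ambiguitySet s) := by
  rw [image_integral_ambiguitySet hcl hbdd]
  refine Convex.is_linear_image ?_ (M.paramProj s).isBoundedLinearMap.toIsLinearMap
  rw [liftedAmbiguitySet_eq_momentMeasures]
  exact convex_image_integral_momentMeasures hbdd.1 fun ν hν =>
    ae_mem_of_mem_momentMeasures hcl hbdd.2.1 hν

theorem isCompact_image_integral_ambiguitySet {s : M.Dec} [Nonempty (A s.1)]
    (hnest : (M.amb s).Nesting) (hconic : (M.amb s).ConicRepresentable)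
    (hbdd : (M.amb s).BoundedSupport) :
    IsCompact ((fun η => ∫ x, x ∂η) '' M.ambiguitySet s) := by
  rw [image_integral_ambiguitySet hconic.isClosed hbdd]
  refine IsCompact.image ?_ (M.paramProj s).continuous
  rw [liftedAmbiguitySet_eq_momentMeasures]
  -- The direction `(0, 1, 0)` changes the rewards only, so transition vectors stay stochastic; it
  -- is nonzero because an action exists.
  refine isCompact_image_integral_momentMeasures (i₀ := Fin.last _) (e := (0, 1, 0))
    hconic.isClosed (fun i => (hconic i).2.1) hnest
    ((M.isClosed_stochasticSet s.1).preimage continuous_fst)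
    ((M.convex_stochasticSet s.1).linear_preimage (LinearMap.fst ℝ _ _)) hbdd.1 hbdd.2.1
    (fun h => ?_) fun x hx t => ?_
  · exact one_ne_zero (congrArg (fun y => y.2.1) h)
  · simpa using hx

/-! ### The one-stage minimax problem -/

/-- The expected value of `r(s, a) + γ v(s')` under fixed parameters. -/
def stageValue (M : DAMDP S A) (s : S) (v : M.Succ s → ℝ) (z : M.Param s) (q : A s → ℝ) : ℝ :=
  ∑ a, q a * (z.2 a + M.γ * ∑ s', z.1 (a, s') * v s')

theorem isLinearMap_stageValue_left (s : S) (v : M.Succ s → ℝ) (q : A s → ℝ) :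
    IsLinearMap ℝ fun z => M.stageValue s v z q := by
  constructor
  · intro x y
    simp only [stageValue, Prod.fst_add, Prod.snd_add, Pi.add_apply, add_mul, mul_add,
      Finset.sum_add_distrib]
    ring
  · intro c x
    simp only [stageValue, Prod.smul_fst, Prod.smul_snd, Pi.smul_apply, smul_eq_mul, mul_assoc,
      ← Finset.mul_sum]
    rw [Finset.mul_sum]
    refine Finset.sum_congr rfl fun a _ => ?_
    ring

theorem isLinearMap_stageValue_right (s : S) (v : M.Succ s → ℝ) (z : M.Param s) :
    IsLinearMap ℝ (M.stageValue s v z) := by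
  constructor
  · intro x y
    simp [stageValue, add_mul, Finset.sum_add_distrib]
  · intro c x
    simp [stageValue, mul_assoc, ← Finset.mul_sum]

theorem stageReward_eq_stageValue {s : S} (v : M.Succ s → ℝ) (q : A s → ℝ)
    {η : Measure (M.Param s)} (hη : Integrable (fun x => x) η) :
    M.stageReward s v q η = M.stageValue s v (∫ x, x ∂η) q :=
  ((isLinearMap_stageValue_left s v q).mk' _).toContinuousLinearMap.integral_comp_comm hη

/-- There is a worst-case distribution that is optimal against all actions simultaneously. -/
theorem exists_worst_mean {s : M.Dec} [Nonempty (A s.1)]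
    (hnest : (M.amb s).Nesting) (hconic : (M.amb s).ConicRepresentable)
    (hbdd : (M.amb s).BoundedSupport) (hne : (M.liftedAmbiguitySet s).Nonempty)
    (v : M.Succ s.1 → ℝ) :
    ∃ η ∈ M.ambiguitySet s, ∃ q₀ ∈ stdSimplex ℝ (A s.1), ∀ q ∈ stdSimplex ℝ (A s.1),
      M.stageValue s.1 v (∫ x, x ∂η) q ≤ M.worstStageReward s v q₀ := by
  classical
  have hcv := convex_image_integral_ambiguitySet hconic.isClosed hbdd
  have hK := isCompact_image_integral_ambiguitySet hnest hconic hbdd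
  have hne' : (M.ambiguitySet s).Nonempty := hne.image _
  -- Sion's theorem for the minimising mean and the maximising action: both sets are compact and
  -- convex, and the payoff is linear in each.
  obtain ⟨_, ⟨η, hη, rfl⟩, q₀, hq₀, h⟩ := Sion.exists_isSaddlePointOn
    (f := fun z q => M.stageValue s.1 v z q) (hne'.image _) hcv hK
    (fun q _ => ((isLinearMap_stageValue_left s.1 v q).mk' _).toContinuousLinearMap.continuous
      |>.lowerSemicontinuous.lowerSemicontinuousOn _)
    (fun q _ => (((isLinearMap_stageValue_left s.1 v q).mk' _).convexOn hcv).quasiconvexOn)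
    (convex_stdSimplex ℝ (A s.1)) ⟨_, single_mem_stdSimplex ℝ (Classical.arbitrary (A s.1))⟩ (isCompact_stdSimplex ℝ (A s.1))
    (fun z _ => ((isLinearMap_stageValue_right s.1 v z).mk' _).toContinuousLinearMap.continuous
      |>.upperSemicontinuous.upperSemicontinuousOn _)
    (fun z _ => (((isLinearMap_stageValue_right s.1 v z).mk' _).concaveOn
      (convex_stdSimplex ℝ (A s.1))).quasiconcaveOn)
  have := hne'.to_subtype
  refine ⟨η, hη, q₀, hq₀, fun q hq => le_ciInf fun η' => ?_⟩
  rw [stageReward_eq_stageValue v q₀ (integrable_of_mem_ambiguitySet hconic.isClosed hbdd η'.2)]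
  exact h _ (mem_image_of_mem _ η'.2) q hq

theorem worstStageReward_le {s : M.Dec} [Nonempty (A s.1)]
    (hnest : (M.amb s).Nesting) (hconic : (M.amb s).ConicRepresentable)
    (hbdd : (M.amb s).BoundedSupport) (v : M.Succ s.1 → ℝ) (q : A s.1 → ℝ)
    {η : Measure (M.Param s.1)} (hη : η ∈ M.ambiguitySet s) :
    M.worstStageReward s v q ≤ M.stageValue s.1 v (∫ x, x ∂η) q := by
  have hK := isCompact_image_integral_ambiguitySet hnest hconic hbdd
  have hint := fun η' hη' =>
    integrable_of_mem_ambiguitySet (η := η') hconic.isClosed hbdd hη'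
  -- An infimum of reals is meaningful only with a lower bound, supplied here by compactness of the
  -- means.
  have hbelow : BddBelow (range fun η' : M.ambiguitySet s => M.stageReward s.1 v q η') := by
    refine (hK.bddBelow_image ((isLinearMap_stageValue_left s.1 v q).mk' _
      ).toContinuousLinearMap.continuous.continuousOn).mono ?_
    rintro _ ⟨η', rfl⟩
    exact ⟨_, mem_image_of_mem _ η'.2, (stageReward_eq_stageValue v q (hint _ η'.2)).symm⟩
  exact (ciInf_le hbelow ⟨η, hη⟩).trans_eq (stageReward_eq_stageValue v q (hint _ hη))

theorem robustValue_eq_iSup (s : M.Dec) :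
    M.robustValue s.1 = ⨆ q : stdSimplex ℝ (A s.1),
      M.worstStageReward s (fun s' => M.robustValue s'.1) q := by
  rw [robustValue, dif_pos s.2]

theorem robustValue_eq_zero {s : S} (hs : ¬ M.stage s < M.T) : M.robustValue s = 0 := by
  rw [robustValue, dif_neg hs]

theorem exists_stageValue_le_robustValue {s : M.Dec} [Nonempty (A s.1)]
    (hnest : (M.amb s).Nesting) (hconic : (M.amb s).ConicRepresentable)
    (hbdd : (M.amb s).BoundedSupport) (hne : (M.liftedAmbiguitySet s).Nonempty) :
    ∃ η ∈ M.ambiguitySet s, ∀ q ∈ stdSimplex ℝ (A s.1),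
      M.stageValue s.1 (fun s' => M.robustValue s'.1) (∫ x, x ∂η) q ≤ M.robustValue s.1 := by
  obtain ⟨η, hη, q₀, hq₀, h⟩ := exists_worst_mean hnest hconic hbdd hne
    (fun s' => M.robustValue s'.1)
  refine ⟨η, hη, fun q hq => (h q hq).trans ?_⟩
  rw [robustValue_eq_iSup]
  have hbound : BddAbove (range fun q : stdSimplex ℝ (A s.1) =>
      M.worstStageReward s (fun s' => M.robustValue s'.1) q) := by
    refine ⟨M.worstStageReward s (fun s' => M.robustValue s'.1) q₀, ?_⟩
    rintro _ ⟨q', rfl⟩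
    exact (worstStageReward_le hnest hconic hbdd _ _ hη).trans (h q' q'.2)
  exact le_ciSup hbound ⟨q₀, hq₀⟩

theorem IsRobustAction.robustValue_le {s : M.Dec} [Nonempty (A s.1)]
    (hnest : (M.amb s).Nesting) (hconic : (M.amb s).ConicRepresentable)
    (hbdd : (M.amb s).BoundedSupport) {q : A s.1 → ℝ} (hq : M.IsRobustAction s q)
    {η : Measure (M.Param s.1)} (hη : η ∈ M.ambiguitySet s) :
    M.robustValue s.1 ≤ M.stageValue s.1 (fun s' => M.robustValue s'.1) (∫ x, x ∂η) q := by
  rw [robustValue_eq_iSup]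
  have : Nonempty (stdSimplex ℝ (A s.1)) := ⟨⟨q, hq.2⟩⟩
  exact (ciSup_le fun q' => hq.1 q'.2).trans (worstStageReward_le hnest hconic hbdd _ _ hη)

end DAMDP

/-- One coordinate is independent of all the others under a product measure. -/
theorem integral_pi_mul_of_dependsOn {ι : Type*} [Fintype ι] {X : ι → Type*}
    [∀ i, MeasurableSpace (X i)] {η : ∀ i, Measure (X i)} [∀ i, IsProbabilityMeasure (η i)]
    {i : ι} {f : X i → ℝ} (hf : Measurable f) {g : (∀ j, X j) → ℝ} (hg : Measurable g)
    (hgi : DependsOn g {i}ᶜ) :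
    ∫ x, f (x i) * g x ∂Measure.pi η = (∫ y, f y ∂η i) * ∫ x, g x ∂Measure.pi η := by
  classical
  have (j : ι) : Nonempty (X j) := (η j).nonempty_of_neZero
  set c : ∀ j, X j := fun j => Classical.arbitrary _
  set T : Finset ι := Finset.univ.erase i with hT
  -- Filling coordinate `i` with a default value, which `g` ignores, turns `g` into a function of
  -- the coordinates in `T`.
  set ext : (∀ j : T, X j) → ∀ j, X j := fun y j => if h : j ∈ T then y ⟨j, h⟩ else c j with hext
  have hext_meas : Measurable ext := by
    refine measurable_pi_lambda _ fun j => ?_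
    by_cases h : j ∈ T
    · simpa [hext, h] using measurable_pi_apply (⟨j, h⟩ : T)
    · simp [hext, h]
  have hgext : ∀ x, g (ext fun j : T => x j) = g x := fun x =>
    hgi fun j hj => dif_pos (Finset.mem_erase.2 ⟨hj, Finset.mem_univ j⟩)
  have hind : ProbabilityTheory.iIndepFun (fun (j : ι) (x : ∀ j, X j) => x j) (Measure.pi η) :=
    ProbabilityTheory.iIndepFun_pi (X := fun _ y => y) fun _ => aemeasurable_id
  have h2 := hind.indepFun_finset {i} T (by simp [hT]) fun j => measurable_pi_apply j
  have h3 := h2.integral_fun_comp_mul_comp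
    (f := fun y => f (y ⟨i, Finset.mem_singleton_self i⟩)) (g := fun y => g (ext y))
    (measurable_pi_lambda _ fun j => measurable_pi_apply _).aemeasurable
    (measurable_pi_lambda _ fun j => measurable_pi_apply _).aemeasurable
    (show Measurable fun y : ∀ j : ({i} : Finset ι), X j =>
      f (y ⟨i, Finset.mem_singleton_self i⟩) from
        hf.comp (measurable_pi_apply _)).aestronglyMeasurable
    (hg.comp hext_meas).aestronglyMeasurable
  simp only [hgext] at h3
  rw [h3, ← (measurePreserving_eval η i).map_eq,
    integral_map (measurable_pi_apply i).aemeasurable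
      (by exact hf.aestronglyMeasurable)]

/-! ### From sums over trajectories to the backward recursion -/

namespace DAMDP

variable {S : Type*} [Fintype S] {A : S → Type*} [∀ s, Fintype (A s)] (M : DAMDP S A)

/-- The expected total reward of the next `n` stages after the history `h`, at the state `s`. -/
def rewardToGo (π : Rule A) (x : ∀ s : M.Dec, M.Param s.1) :
    ℕ → List (Σ s, A s) → S → ℝ
  | 0, _, _ => 0
  | n + 1, h, s => ∑ a, π h s a *
      (M.reward x s a + M.γ * ∑ s', M.trans x s a s' * rewardToGo π x n (h ++ [⟨s, a⟩]) s')

open Classical in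
/-- The probability of the trajectory `τ` of `n` stages after the history `h`, at the state `s`. -/
def trajWeight (π : Rule A) (x : ∀ s : M.Dec, M.Param s.1) (n : ℕ) (h : List (Σ s, A s)) (s : S)
    (τ : Fin n → Σ s, A s) : ℝ :=
  (if ∀ i : Fin n, (i : ℕ) = 0 → (τ i).1 = s then 1 else 0) *
    (∏ i : Fin n, π (h ++ (List.ofFn τ).take i) (τ i).1 (τ i).2) *
    ∏ i : Fin n,
      if h : (i : ℕ) + 1 < n then M.trans x (τ i).1 (τ i).2 (τ ⟨i + 1, h⟩).1 else 1

variable {M} {π : Rule A} {x : ∀ s : M.Dec, M.Param s.1}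

open Classical in
theorem trajWeight_one (h : List (Σ s, A s)) (s : S) (τ : Fin 1 → Σ s, A s) :
    M.trajWeight π x 1 h s τ = if (τ 0).1 = s then π h (τ 0).1 (τ 0).2 else 0 := by
  simp [trajWeight]

open Classical in
theorem trajWeight_cons (n : ℕ) (h : List (Σ s, A s)) (s : S) (y : Σ s, A s)
    (τ : Fin (n + 1) → Σ s, A s) :
    M.trajWeight π x (n + 2) h s (Fin.cons y τ) =
      if y.1 = s then π h y.1 y.2 * ∑ s', M.trans x y.1 y.2 s' *
        M.trajWeight π x (n + 1) (h ++ [y]) s' τ else 0 := by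
  have hind : ∀ {k : ℕ} (σ : Fin (k + 1) → Σ s, A s) (t : S),
      (∀ i : Fin (k + 1), (i : ℕ) = 0 → (σ i).1 = t) ↔ (σ 0).1 = t := fun {k} σ t =>
    ⟨fun H => H 0 rfl, fun H i hi => by
      have : i = 0 := Fin.ext hi
      rw [this, H]⟩
  -- The indicator of the starting state leaves a single successor, the first state of `τ`.
  have hsum : ∑ s', M.trans x y.1 y.2 s' * M.trajWeight π x (n + 1) (h ++ [y]) s' τ =
      M.trans x y.1 y.2 (τ 0).1 * M.trajWeight π x (n + 1) (h ++ [y]) (τ 0).1 τ := by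
    refine Finset.sum_eq_single _ (fun t _ ht => ?_) (by simp)
    rw [trajWeight, if_neg ((hind τ t).not.2 (Ne.symm ht))]
    simp
  rw [hsum]
  simp only [trajWeight, hind]
  rw [Fin.prod_univ_succ (n := n + 1), Fin.prod_univ_succ (n := n + 1)]
  by_cases hy : y.1 = s
  · simp [hy, List.ofFn_succ]
    exact (by intros; ring : ∀ a b c d : ℝ, a * b * (c * d) = a * (c * (b * d))) _ _ _ _
  · simp [hy]

open Classical in
theorem sum_trajectories_succ (n : ℕ) (s : S) (f : (Σ s, A s) → (Fin n → Σ s, A s) → ℝ) :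
    ∑ τ : Fin (n + 1) → Σ s, A s, (if (τ 0).1 = s then f (τ 0) (Fin.tail τ) else 0) =
      ∑ a : A s, ∑ τ, f ⟨s, a⟩ τ := by
  rw [← (Fin.consEquiv fun _ => Σ s, A s).sum_comp, Fintype.sum_prod_type, Fintype.sum_sigma,
    Finset.sum_eq_single s]
  · simp [Fin.consEquiv]
  · intro t _ ht
    simp [ht]
  · simp

theorem sum_trans_mul {s : S} (hs : M.stage s < M.T) (a : A s) (v : S → ℝ) :
    ∑ s', M.trans x s a s' * v s' = ∑ s' : M.Succ s, (x ⟨s, hs⟩).1 (a, s') * v s' := by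
  classical
  have h := Finset.sum_subtype (F := inferInstance) (p := fun s' => M.stage s' = M.stage s + 1)
    (Finset.univ.filter fun s' => M.stage s' = M.stage s + 1) (by simp)
    fun s' => M.trans x s a s' * v s'
  rw [Finset.sum_filter] at h
  refine (Finset.sum_congr rfl fun s' _ => ?_).trans (h.trans (Finset.sum_congr rfl fun s' _ => ?_))
  · by_cases hs' : M.stage s' = M.stage s + 1 <;> simp [trans, hs']
  · rw [trans, dif_pos ⟨hs, s'.2⟩]

theorem sum_trans (hx : ∀ s, (x s).1 ∈ M.stochasticSet s.1) {s : S} (hs : M.stage s < M.T)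
    (a : A s) : ∑ s', M.trans x s a s' = 1 := by
  have h := sum_trans_mul (x := x) hs a fun _ => 1
  simp only [mul_one] at h
  exact h.trans (hx ⟨s, hs⟩ a).2

theorem sum_trans_mul_congr {s : S} (a : A s) {v w : S → ℝ}
    (h : ∀ s', M.stage s' = M.stage s + 1 → v s' = w s') :
    ∑ s', M.trans x s a s' * v s' = ∑ s', M.trans x s a s' * w s' := by
  refine Finset.sum_congr rfl fun s' _ => ?_
  by_cases hs' : M.stage s' = M.stage s + 1
  · rw [h s' hs']
  · simp [trans, hs']

theorem sum_trajWeight_succ_mul (n : ℕ) (h : List (Σ s, A s)) (s : S)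
    (f : (Σ s, A s) → (Fin (n + 1) → Σ s, A s) → ℝ) :
    ∑ τ, M.trajWeight π x (n + 2) h s τ * f (τ 0) (Fin.tail τ) =
      ∑ a, π h s a * ∑ s', M.trans x s a s' *
        ∑ τ, M.trajWeight π x (n + 1) (h ++ [⟨s, a⟩]) s' τ * f ⟨s, a⟩ τ := by
  classical
  have h1 : ∀ τ : Fin (n + 2) → Σ s, A s, M.trajWeight π x (n + 2) h s τ * f (τ 0) (Fin.tail τ) =
      if (τ 0).1 = s then (π h (τ 0).1 (τ 0).2 * ∑ s', M.trans x (τ 0).1 (τ 0).2 s' *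
        M.trajWeight π x (n + 1) (h ++ [τ 0]) s' (Fin.tail τ)) * f (τ 0) (Fin.tail τ) else 0 := by
    intro τ
    conv_lhs => rw [← Fin.cons_self_tail τ, trajWeight_cons]
    simp only [Fin.cons_zero, Fin.tail_cons, ite_mul, zero_mul]
  simp_rw [h1]
  rw [sum_trajectories_succ (n + 1) s fun y τ => (π h y.1 y.2 * ∑ s', M.trans x y.1 y.2 s' *
        M.trajWeight π x (n + 1) (h ++ [y]) s' τ) * f y τ]
  refine Finset.sum_congr rfl fun a _ => ?_
  simp_rw [Finset.mul_sum, Finset.sum_mul]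
  rw [Finset.sum_comm]
  refine Finset.sum_congr rfl fun s' _ => Finset.sum_congr rfl fun τ _ => ?_
  ring

/-- With `n` transitions left there are `n + 1` actions to draw, the last one at stage `T`. Total
mass one lets the immediate reward be pulled out of the trajectory sum. -/
theorem sum_trajWeight (hπ : π ∈ strategies A) (hx : ∀ s, (x s).1 ∈ M.stochasticSet s.1) (n : ℕ)
    (h : List (Σ s, A s)) (s : S) (hs : M.stage s + n = M.T) :
    ∑ τ, M.trajWeight π x (n + 1) h s τ = 1 := by
  classical
  induction n generalizing h s with
  | zero =>
    rw [Finset.sum_congr rfl fun τ _ => trajWeight_one h s τ,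
      sum_trajectories_succ 0 s fun y _ => π h y.1 y.2]
    simpa using (hπ h s).2
  | succ n ih =>
    have h1 := sum_trajWeight_succ_mul (M := M) (π := π) (x := x) n h s fun _ _ => 1
    simp only [mul_one] at h1
    rw [h1, ← (hπ h s).2]
    refine Finset.sum_congr rfl fun a _ => ?_
    rw [sum_trans_mul_congr (w := fun _ => 1) a fun s' hs' => ih _ s' (by omega)]
    simp [sum_trans hx (show M.stage s < M.T by omega)]

theorem sum_trajWeight_mul_reward (hπ : π ∈ strategies A)
    (hx : ∀ s, (x s).1 ∈ M.stochasticSet s.1) (n : ℕ)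
    (h : List (Σ s, A s)) (s : S) (hs : M.stage s + n = M.T) :
    ∑ τ, M.trajWeight π x (n + 1) h s τ *
      ∑ i : Fin (n + 1), M.γ ^ (i : ℕ) * M.reward x (τ i).1 (τ i).2 =
        M.rewardToGo π x (n + 1) h s := by
  classical
  induction n generalizing h s with
  | zero =>
    have hzero : M.rewardToGo π x 1 h s = 0 := by
      simp [rewardToGo, reward, show ¬ M.stage s < M.T by omega]
    refine (Finset.sum_eq_zero fun τ _ => ?_).trans hzero.symm
    rw [trajWeight_one]
    split_ifs with hτ
    · simp [reward, hτ, show ¬ M.stage s < M.T by omega]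
    · simp
  | succ n ih =>
    have hsplit : ∀ τ : Fin (n + 2) → Σ s, A s,
        ∑ i : Fin (n + 2), M.γ ^ (i : ℕ) * M.reward x (τ i).1 (τ i).2 =
          M.reward x (τ 0).1 (τ 0).2 +
          M.γ * ∑ i : Fin (n + 1), M.γ ^ (i : ℕ) *
            M.reward x (Fin.tail τ i).1 (Fin.tail τ i).2 := by
      intro τ
      rw [Fin.sum_univ_succ, Finset.mul_sum]
      simp [Fin.tail, pow_succ', mul_assoc]
    simp_rw [hsplit]
    rw [sum_trajWeight_succ_mul n h s fun y τ => M.reward x y.1 y.2 +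
      M.γ * ∑ i : Fin (n + 1), M.γ ^ (i : ℕ) * M.reward x (τ i).1 (τ i).2]
    rw [rewardToGo]
    refine Finset.sum_congr rfl fun a _ => ?_
    congr 1
    rw [sum_trans_mul_congr (w := fun s' => M.reward x s a +
      M.γ * M.rewardToGo π x (n + 1) (h ++ [⟨s, a⟩]) s') a fun s' hs' => ?_]
    · simp only [mul_add, Finset.sum_add_distrib, ← Finset.sum_mul,
        sum_trans hx (show M.stage s < M.T by omega), one_mul]
      rw [Finset.mul_sum]
      congr 1
      refine Finset.sum_congr rfl fun s' _ => ?_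
      ring
    · simp only [mul_add, Finset.sum_add_distrib, ← Finset.sum_mul]
      rw [sum_trajWeight hπ hx n _ s' (by omega), one_mul, ← ih _ s' (by omega), Finset.mul_sum]
      congr 1
      refine Finset.sum_congr rfl fun τ _ => ?_
      ring

theorem totalReward_eq_rewardToGo (hT : M.stage M.sIni = 1) (hT' : 1 ≤ M.T)
    (hπ : π ∈ strategies A) (hx : ∀ s, (x s).1 ∈ M.stochasticSet s.1) :
    M.totalReward π x = M.rewardToGo π x M.T [] M.sIni := by
  obtain ⟨n, hn⟩ := Nat.exists_eq_add_of_le' hT'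
  have key := sum_trajWeight_mul_reward hπ hx n [] M.sIni (by omega)
  rw [← hn] at key
  rw [← key]
  rfl

end DAMDP

/-! ### Expectation of the recursion under product distributions -/

namespace DAMDP

variable {S : Type*} [Fintype S] {A : S → Type*} [∀ s, Fintype (A s)] {M : DAMDP S A} {π : Rule A}

theorem continuous_reward (s : S) (a : A s) : Continuous fun x => M.reward x s a := by
  unfold reward
  split_ifs <;> fun_prop

theorem continuous_trans (s : S) (a : A s) (s' : S) : Continuous fun x => M.trans x s a s' := by
  unfold trans
  split_ifs <;> fun_prop

theorem continuous_rewardToGo (n : ℕ) (h : List (Σ s, A s)) (s : S) :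
    Continuous fun x => M.rewardToGo π x n h s := by
  induction n generalizing h s with
  | zero => exact continuous_const
  | succ n ih =>
    simp only [rewardToGo]
    have h1 := M.continuous_reward s
    have h2 := M.continuous_trans s
    fun_prop

theorem dependsOn_rewardToGo (n : ℕ) (h : List (Σ s, A s)) (s : S) :
    DependsOn (fun x => M.rewardToGo π x n h s) {t : M.Dec | M.stage s ≤ M.stage t.1} := by
  induction n generalizing h s with
  | zero => exact fun _ _ _ => rfl
  | succ n ih =>
    intro x y hxy
    simp only [rewardToGo]
    refine Finset.sum_congr rfl fun a _ => ?_
    have hr : M.reward x s a = M.reward y s a := by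
      unfold reward
      split_ifs with hs
      · rw [hxy ⟨s, hs⟩ (le_refl (M.stage s))]
      · rfl
    rw [hr]
    congr 3
    refine Finset.sum_congr rfl fun s' _ => ?_
    unfold trans
    split_ifs with hs
    · have hv : M.rewardToGo π x n (h ++ [⟨s, a⟩]) s' = M.rewardToGo π y n (h ++ [⟨s, a⟩]) s' :=
        ih (h ++ [⟨s, a⟩]) s' fun t ht => hxy t ?_
      · rw [hxy ⟨s, hs.1⟩ (le_refl (M.stage s)), hv]
      have : M.stage s' ≤ M.stage t.1 := ht
      change M.stage s ≤ M.stage t.1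
      omega
    · rw [zero_mul, zero_mul]

section Integral

variable {η : ∀ s : M.Dec, Measure (M.Param s.1)} [∀ s, IsProbabilityMeasure (η s)]
  {K : ∀ s : M.Dec, Set (M.Param s.1)}

theorem integrable_pi_of_continuous (hK : ∀ s, IsCompact (K s)) (hη : ∀ s, ∀ᵐ x ∂η s, x ∈ K s)
    {f : (∀ s : M.Dec, M.Param s.1) → ℝ} (hf : Continuous f) :
    Integrable f (Measure.pi η) := by
  obtain ⟨C, hC⟩ := (isCompact_univ_pi hK).exists_bound_of_continuousOn hf.continuousOn
  refine Integrable.of_bound hf.aestronglyMeasurable C ?_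
  have hae : ∀ᵐ x ∂Measure.pi η, ∀ s, x s ∈ K s :=
    eventually_all.2 fun s => Measure.tendsto_eval_ae_ae.eventually (hη s)
  exact hae.mono fun x hx => hC x fun s _ => hx s

theorem integral_pi_clm (hK : ∀ s, IsCompact (K s)) (hη : ∀ s, ∀ᵐ x ∂η s, x ∈ K s) (s : M.Dec)
    (L : M.Param s.1 →L[ℝ] ℝ) :
    ∫ x, L (x s) ∂Measure.pi η = L (∫ y, y ∂η s) := by
  rw [← L.integral_comp_comm (integrable_id_of_ae_mem_isBounded (hK s).isBounded (hη s)),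
    ← (measurePreserving_eval η s).map_eq,
    integral_map (measurable_pi_apply s).aemeasurable
      (by exact L.continuous.aestronglyMeasurable)]

/-- In the recursion, the transition out of `s` multiplies a continuation that sees only later
stages, so the expectation of the product factors. -/
theorem integral_rewardToGo (hK : ∀ s, IsCompact (K s)) (hη : ∀ s, ∀ᵐ x ∂η s, x ∈ K s)
    (n : ℕ) (h : List (Σ s, A s)) (s : S) :
    ∫ x, M.rewardToGo π x n h s ∂Measure.pi η =
      M.rewardToGo π (fun s => ∫ y, y ∂η s) n h s := by
  induction n generalizing h s with
  | zero => simp [rewardToGo]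
  | succ n ih =>
    have hint := fun {f} hf => integrable_pi_of_continuous (f := f) hK hη hf
    have hr := M.continuous_reward s
    have ht := M.continuous_trans s
    have hv := fun h s => M.continuous_rewardToGo (π := π) n h s
    have hreward : ∀ a, ∫ x, M.reward x s a ∂Measure.pi η =
        M.reward (fun s => ∫ y, y ∂η s) s a := by
      intro a
      unfold reward
      split_ifs with hs
      · exact integral_pi_clm hK hη ⟨s, hs⟩
          (ContinuousLinearMap.proj a ∘L ContinuousLinearMap.snd ℝ _ _)
      · simp
    have htrans : ∀ a s', ∫ x, M.trans x s a s' * M.rewardToGo π x n (h ++ [⟨s, a⟩]) s'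
        ∂Measure.pi η = M.trans (fun s => ∫ y, y ∂η s) s a s' *
          M.rewardToGo π (fun s => ∫ y, y ∂η s) n (h ++ [⟨s, a⟩]) s' := by
      intro a s'
      rw [← ih]
      unfold trans
      split_ifs with hs
      · set L : M.Param s →L[ℝ] ℝ :=
          ContinuousLinearMap.proj (a, ⟨s', hs.2⟩) ∘L ContinuousLinearMap.fst ℝ _ _ with hL
        have h1 := integral_pi_mul_of_dependsOn (η := η) (i := ⟨s, hs.1⟩) (f := L)
          L.continuous.measurable (hv (h ++ [⟨s, a⟩]) s').measurable
          ((dependsOn_rewardToGo n _ s').mono fun t ht => ?_)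
        · refine h1.trans ?_
          rw [L.integral_comp_comm (integrable_id_of_ae_mem_isBounded (hK _).isBounded (hη _))]
          rfl
        · rintro rfl
          have : M.stage s' ≤ M.stage s := ht
          omega
      · simp
    simp only [rewardToGo]
    rw [integral_finsetSum _ fun a _ => hint (by fun_prop)]
    refine Finset.sum_congr rfl fun a _ => ?_
    rw [integral_const_mul, integral_add (hint (by fun_prop)) (hint (by fun_prop)), hreward,
      integral_const_mul, integral_finsetSum _ fun s' _ => hint (by fun_prop)]
    simp_rw [htrans]

end Integral

theorem performance_pi_eq_rewardToGo (hstage : M.Staged)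
    (hconic : ∀ s, (M.amb s).ConicRepresentable) (hbdd : ∀ s, (M.amb s).BoundedSupport)
    (hπ : π ∈ strategies A) {η : ∀ s : M.Dec, Measure (M.Param s.1)}
    (hη : ∀ s, η s ∈ M.ambiguitySet s) :
    M.performance π (Measure.pi η) =
      M.rewardToGo π (fun s => ∫ y, y ∂η s) M.T [] M.sIni := by
  have (s : M.Dec) : IsProbabilityMeasure (η s) := isProbabilityMeasure_of_mem_ambiguitySet (hη s)
  choose K hK hKη using fun s => exists_isCompact_ae_mem (hconic s).isClosed (hbdd s)
  have hT : M.stage M.sIni = 1 := (hstage.2 _).2 rfl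
  rw [← integral_rewardToGo hK fun s => hKη s _ (hη s)]
  -- The trajectory sum is identified with the recursion for stochastic transition vectors, hence
  -- almost surely.
  refine integral_congr_ae ?_
  have hae : ∀ᵐ x ∂Measure.pi η, ∀ s, (x s).1 ∈ M.stochasticSet s.1 := eventually_all.2 fun s =>
    (Measure.tendsto_eval_ae_ae (i := s)).eventually (ae_stochastic_of_mem_ambiguitySet (hη s))
  exact hae.mono fun x hx => totalReward_eq_rewardToGo hT (hT ▸ (hstage.1 M.sIni).2) hπ hx

/-! ### Comparison with the robust value by backward induction -/

theorem rewardToGo_succ (s : M.Dec) (x : ∀ s : M.Dec, M.Param s.1) (n : ℕ)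
    (h : List (Σ s, A s)) :
    M.rewardToGo π x (n + 1) h s.1 = ∑ a, π h s.1 a * ((x s).2 a + M.γ *
      ∑ s' : M.Succ s.1, (x s).1 (a, s') * M.rewardToGo π x n (h ++ [⟨s.1, a⟩]) s'.1) := by
  rw [rewardToGo]
  refine Finset.sum_congr rfl fun a _ => ?_
  rw [sum_trans_mul s.2, reward, dif_pos s.2]

theorem rewardToGo_eq_zero {s : S} (hs : ¬ M.stage s < M.T) (x : ∀ s : M.Dec, M.Param s.1) (n : ℕ)
    (h : List (Σ s, A s)) : M.rewardToGo π x n h s = 0 := by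
  cases n <;> simp [rewardToGo, reward, trans, hs]

/-- The one-stage recursion is monotone in the continuation because `γ`, the action weights and the
transition probabilities are nonnegative. The history plays no role: whatever it is, the rule gives
a point of the simplex. -/
theorem rewardToGo_le_robustValue (hγ : 0 ≤ M.γ) (hπ : π ∈ strategies A)
    {x : ∀ s : M.Dec, M.Param s.1} (hx : ∀ s, (x s).1 ∈ M.stochasticSet s.1)
    (hv : ∀ s : M.Dec, ∀ q ∈ stdSimplex ℝ (A s.1),
      M.stageValue s.1 (fun s' => M.robustValue s'.1) (x s) q ≤ M.robustValue s.1)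
    (n : ℕ) (h : List (Σ s, A s)) (s : S) (hs : M.T ≤ M.stage s + n) :
    M.rewardToGo π x n h s ≤ M.robustValue s := by
  induction n generalizing h s with
  | zero => rw [robustValue_eq_zero (by omega), rewardToGo]
  | succ n ih =>
    by_cases hsT : M.stage s < M.T
    · refine le_trans ?_ (hv ⟨s, hsT⟩ _ (hπ h s))
      rw [rewardToGo_succ ⟨s, hsT⟩, stageValue]
      gcongr with a _ s' _
      · exact (hπ h s).1 a
      · exact (hx ⟨s, hsT⟩ a).1 s'
      · exact ih _ _ (by have := s'.2; dsimp only at this; omega)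
    · rw [robustValue_eq_zero hsT, rewardToGo_eq_zero hsT]

theorem IsHistory.concat {h : List (Σ s, A s)} {s s' : S} (hh : M.IsHistory h s) (a : A s)
    (hs' : M.stage s' = M.stage s + 1) : M.IsHistory (h ++ [⟨s, a⟩]) s' := by
  refine ⟨fun i hi => ?_, by simp [hs', hh.2]⟩
  rw [List.getElem_append]
  split_ifs with hlt
  · exact hh.1 i hlt
  · have : i = h.length := by
      simp at hi
      omega
    simp [this, hh.2]

/-- The same monotonicity, but optimality of the actions is known only after genuine histories, so
the induction must stay among them. -/
theorem robustValue_le_rewardToGo (hγ : 0 ≤ M.γ) (hπ : π ∈ strategies A)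
    {x : ∀ s : M.Dec, M.Param s.1} (hx : ∀ s, (x s).1 ∈ M.stochasticSet s.1)
    (hv : ∀ (s : M.Dec) (h : List (Σ s, A s)), M.IsHistory h s.1 →
      M.robustValue s.1 ≤ M.stageValue s.1 (fun s' => M.robustValue s'.1) (x s) (π h s.1))
    (n : ℕ) (h : List (Σ s, A s)) (s : S) (hh : M.IsHistory h s) (hs : M.T ≤ M.stage s + n) :
    M.robustValue s ≤ M.rewardToGo π x n h s := by
  induction n generalizing h s with
  | zero => rw [robustValue_eq_zero (by omega), rewardToGo]
  | succ n ih =>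
    by_cases hsT : M.stage s < M.T
    · refine (hv ⟨s, hsT⟩ h hh).trans ?_
      rw [rewardToGo_succ ⟨s, hsT⟩, stageValue]
      gcongr with a _ s' _
      · exact (hπ h s).1 a
      · exact (hx ⟨s, hsT⟩ a).1 s'
      · exact ih _ _ (hh.concat a s'.2) (by have := s'.2; dsimp only at this; omega)
    · rw [robustValue_eq_zero hsT, rewardToGo_eq_zero hsT]

end DAMDP

end

/-! ### The saddle point -/

theorem theorem1 {S : Type*} [Fintype S] {A : S → Type*} [∀ s, Fintype (A s)]
    [∀ s, Nonempty (A s)] (M : DAMDP S A)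
    (hγ : 0 < M.γ) (hγ' : M.γ ≤ 1) (hstage : M.Staged)
    (hnest : ∀ s, (M.amb s).Nesting)
    (hconic : ∀ s, (M.amb s).ConicRepresentable)
    (hbdd : ∀ s, (M.amb s).BoundedSupport)
    (hne : ∀ s, (M.liftedAmbiguitySet s).Nonempty)
    (π : DAMDP.Rule A) (hπ : M.IsSRobust π) :
    M.IsDistributionallyRobust π ∧
      ∃ μ ∈ M.productSet,
        IsLUB ((fun π' => M.performance π' μ) '' DAMDP.strategies A) (M.performance π μ) ∧
        IsGLB ((fun ν => M.performance π ν) '' M.productSet) (M.performance π μ) := by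
  choose η hη hηv using fun s => DAMDP.exists_stageValue_le_robustValue (hnest s) (hconic s)
    (hbdd s) (hne s)
  have hstoch : ∀ {η' : ∀ s : M.Dec, Measure (M.Param s.1)} (_ : ∀ s, η' s ∈ M.ambiguitySet s) s,
      (∫ y, y ∂η' s).1 ∈ M.stochasticSet s.1 := fun hη' s =>
    DAMDP.integral_stochastic_of_mem_ambiguitySet (hconic s).isClosed (hbdd s) (hη' s)
  have hmem : Measure.pi η ∈ M.productSet := by
    rw [DAMDP.productSet_eq]
    exact ⟨η, hη, rfl⟩
  have hupper : ∀ π' ∈ DAMDP.strategies A,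
      M.performance π' (Measure.pi η) ≤ M.robustValue M.sIni := fun π' hπ' => by
    rw [DAMDP.performance_pi_eq_rewardToGo hstage hconic hbdd hπ' hη]
    exact DAMDP.rewardToGo_le_robustValue hγ.le hπ' (hstoch hη) hηv _ _ _ (by omega)
  have hlower : ∀ ν ∈ M.productSet, M.robustValue M.sIni ≤ M.performance π ν := by
    rw [DAMDP.productSet_eq]
    rintro _ ⟨η', hη', rfl⟩
    rw [DAMDP.performance_pi_eq_rewardToGo hstage hconic hbdd hπ.1 hη']
    refine DAMDP.robustValue_le_rewardToGo hγ.le hπ.1 (hstoch hη') (fun s h hh =>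
      (hπ.2 s h hh).robustValue_le (hnest s) (hconic s) (hbdd s) (hη' s)) _ _ _ ?_ (by omega)
    exact ⟨fun i hi => absurd hi (by simp), by simp [(hstage.2 M.sIni).2 rfl]⟩
  -- The two bounds meet at this pair, which gives both halves of the saddle point.
  have heq : M.performance π (Measure.pi η) = M.robustValue M.sIni :=
    le_antisymm (hupper π hπ.1) (hlower _ hmem)
  refine ⟨⟨hπ.1, fun π' hπ' => ?_⟩, Measure.pi η, hmem, ⟨?_, ?_⟩, ?_, ?_⟩
  · refine (iInf₂_le _ hmem).trans (le_iInf₂ fun ν hν => ?_)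
    exact EReal.coe_le_coe_iff.2 ((hupper π' hπ').trans (hlower ν hν))
  · rintro _ ⟨π', hπ', rfl⟩
    exact (hupper π' hπ').trans_eq heq.symm
  · exact fun b hb => hb ⟨π, hπ.1, rfl⟩
  · rintro _ ⟨ν, hν, rfl⟩
    exact heq.trans_le (hlower ν hν)
  · exact fun b hb => hb ⟨_, hmem, rfl⟩
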